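/- Let $T\subset\mathbb R^3$ be a non-degenerate (closed) triangle with vertices $p_1,p_2,p_3$, indices being understood cyclically modulo $3$, and put $\mathbf s_i=p_{i-1}-p_{i+1}$ (the side opposite to $p_i$, running from $p_{i+1}$ to $p_{i-1}$), $\hat{\mathbf s}_i=\mathbf s_i/|\mathbf s_i|$, $\hat{\mathbf w}=(\mathbf s_1\times\mathbf s_2)/|\mathbf s_1\times\mathbf s_2|$ and $\hat{\mathbf m}_i=\hat{\mathbf s}_i\times\hat{\mathbf w}$ for $i=1,2,3$. Let $r_0\in\mathbb R^3$ be a point not in the plane of $T$, and write $r_0=\rho-w_0\hat{\mathbf w}$, where $\rho$ is the orthogonal projection of $r_0$ onto the plane of $T$ and $w_0=(p_1-r_0)\cdot\hat{\mathbf w}\neq0$. For $i=1,2,3$ let $$t_i^0=(p_{i+1}-\rho)\cdot\hat{\mathbf m}_i,\qquad s_i^-=(p_{i+1}-\rho)\cdot\hat{\mathbf s}_i,\qquad s_i^+=(p_{i-1}-\rho)\cdot\hat{\mathbf s}_i,$$ $$R_i^0=\sqrt{(t_i^0)^2+w_0^2},\qquad R_i^\pm=\sqrt{(s_i^\pm)^2+(t_i^0)^2+w_0^2},\qquad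 R_i^s=\frac1{(R_i^0)^2}\left(\frac{s_i^+}{R_i^+}-\frac{s_i^-}{R_i^-}\right),$$ $$\beta_i=\arctan\frac{t_i^0s_i^+}{(R_i^0)^2+|w_0|R_i^+}-\arctan\frac{t_i^0s_i^-}{(R_i^0)^2+|w_0|R_i^-},\qquad \beta=\beta_1+\beta_2+\beta_3,$$ where $\arctan$ is the principal branch, with values in $(-\pi/2,\pi/2)$. With $R=|r-r_0|$ and $dT$ the surface (area) measure on $T$, the function $R^{-5}$ is integrable over $T$ and $$\int_T\frac{dT}{R^5}=\frac13\left(\frac{\beta}{|w_0|^3}+\sum_{i=1}^3\frac{t_i^0}{w_0^2}R_i^s\right).$$ This holds wherever the projection $\rho$ lies: inside $T$, outside $T$, on a side, or at a vertex. -/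

import Mathlib

open MeasureTheory
open scoped Matrix

noncomputable section

namespace TriangleIntegral

/-- Euclidean three-dimensional space. -/
abbrev E3 : Type := EuclideanSpace ℝ (Fin 3)

/-- The cross product on Euclidean space. -/
def cross (a b : E3) : E3 := WithLp.toLp 2 (a.ofLp ⨯₃ b.ofLp)

/-- The unit vector in the direction of `a`. -/
def unit (a : E3) : E3 := ‖a‖⁻¹ • a

/-- The triangle as a closed planar region of space. -/
def region (T : Affine.Triangle ℝ E3) : Set E3 := convexHull ℝ (Set.range T.points)

/-- The edge vector `s i = p (i - 1) - p (i + 1)` opposite to the vertex `p i`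
(the indices `0, 1, 2` are cyclic). -/
def edge (T : Affine.Triangle ℝ E3) (i : Fin 3) : E3 := T.points (i - 1) - T.points (i + 1)

/-- The unit edge direction. -/
def sHat (T : Affine.Triangle ℝ E3) (i : Fin 3) : E3 := unit (edge T i)

/-- The unit normal of the plane of the triangle. -/
def wHat (T : Affine.Triangle ℝ E3) : E3 := unit (cross (edge T 0) (edge T 1))

/-- The unit normal of the `i`-th edge in the plane of the triangle, pointing outwards. -/
def mHat (T : Affine.Triangle ℝ E3) (i : Fin 3) : E3 := cross (sHat T i) (wHat T)

/-- The signed height `w₀`, so that `r₀ = ρ - w₀ ŵ` with `ρ` in the plane of the triangle. -/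
def w0 (T : Affine.Triangle ℝ E3) (r0 : E3) : ℝ := inner ℝ (T.points 0 - r0) (wHat T)

/-- The orthogonal projection `ρ` of `r₀` onto the plane of the triangle. -/
def rho (T : Affine.Triangle ℝ E3) (r0 : E3) : E3 := r0 + w0 T r0 • wHat T

/-- The signed distance `tᵢ⁰` from `ρ` to the line carrying the `i`-th edge: the foot of the
perpendicular is `ρ + tᵢ⁰ m̂ᵢ`. -/
def t0 (T : Affine.Triangle ℝ E3) (r0 : E3) (i : Fin 3) : ℝ :=
  inner ℝ (T.points (i + 1) - rho T r0) (mHat T i)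

/-- The arc-length coordinate `sᵢ⁻` of the starting point `p (i + 1)` of the `i`-th edge, measured
from the foot of the perpendicular in the direction `ŝᵢ`. -/
def sMinus (T : Affine.Triangle ℝ E3) (r0 : E3) (i : Fin 3) : ℝ :=
  inner ℝ (T.points (i + 1) - rho T r0) (sHat T i)

/-- The arc-length coordinate `sᵢ⁺` of the end point `p (i - 1)` of the `i`-th edge, measured
from the foot of the perpendicular in the direction `ŝᵢ`. -/
def sPlus (T : Affine.Triangle ℝ E3) (r0 : E3) (i : Fin 3) : ℝ :=
  inner ℝ (T.points (i - 1) - rho T r0) (sHat T i)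

/-- `Rᵢ⁰`, the distance from `r₀` to the line carrying the `i`-th edge. -/
def R0 (T : Affine.Triangle ℝ E3) (r0 : E3) (i : Fin 3) : ℝ :=
  Real.sqrt (t0 T r0 i ^ 2 + w0 T r0 ^ 2)

/-- `Rᵢ⁻`, the distance from `r₀` to the starting point of the `i`-th edge. -/
def RMinus (T : Affine.Triangle ℝ E3) (r0 : E3) (i : Fin 3) : ℝ :=
  Real.sqrt (sMinus T r0 i ^ 2 + t0 T r0 i ^ 2 + w0 T r0 ^ 2)

/-- `Rᵢ⁺`, the distance from `r₀` to the end point of the `i`-th edge. -/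
def RPlus (T : Affine.Triangle ℝ E3) (r0 : E3) (i : Fin 3) : ℝ :=
  Real.sqrt (sPlus T r0 i ^ 2 + t0 T r0 i ^ 2 + w0 T r0 ^ 2)

/-- The edge function `Rᵢˢ`. -/
def Rs (T : Affine.Triangle ℝ E3) (r0 : E3) (i : Fin 3) : ℝ :=
  1 / R0 T r0 i ^ 2 * (sPlus T r0 i / RPlus T r0 i - sMinus T r0 i / RMinus T r0 i)

/-- The edge term `βᵢ`, with the principal branch of the arctangent. -/
def betaEdge (T : Affine.Triangle ℝ E3) (r0 : E3) (i : Fin 3) : ℝ :=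
  Real.arctan (t0 T r0 i * sPlus T r0 i / (R0 T r0 i ^ 2 + |w0 T r0| * RPlus T r0 i)) -
    Real.arctan (t0 T r0 i * sMinus T r0 i / (R0 T r0 i ^ 2 + |w0 T r0| * RMinus T r0 i))

/-- `β = β₁ + β₂ + β₃`. -/
def beta (T : Affine.Triangle ℝ E3) (r0 : E3) : ℝ := ∑ i : Fin 3, betaEdge T r0 i

end TriangleIntegral

end

noncomputable section

namespace TriangleIntegral

/-! Write `a = |w₀|`. In the plane of the triangle, `R² = |r - ρ|² + a²`, so a field `g(R²)(r - ρ)`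
has divergence `2g + 2(R² - a²)g'`. Setting this equal to `R⁻⁵` and requiring regularity at `ρ`
gives `g = (a⁻³ - R⁻³) / (3(R² - a²))`. Cancelling `R - a` turns this into `radial`, which is smooth
on the whole plane because `R ≥ a > 0`. No disc around `ρ` has to be removed, so the position of `ρ`
never matters.

By the divergence theorem the integral is the sum of the fluxes through the sides. On side `i` the
normal component of `r - ρ` is the constant `tᵢ⁰`, so the flux is `tᵢ⁰ ∫ g ds`. The antiderivative
`edgePrimitive` evaluates it as the `βᵢ` and `Rᵢˢ` terms (`integral_segment_radial`).

The divergence theorem is applied in affine coordinates on the standard triangle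
(`integral_stdTriangle_radial`), where the side weights are the barycentric coordinates of `ρ`.
These match the geometric weights because `tᵢ⁰ |sᵢ|` is `|a × b|` times the `i`-th barycentric
coordinate, where `a`, `b` now denote the sides issuing from the vertex `p 0`. -/

/-! ### Surface measure on a parametrised plane -/

/-- The affine parametrisation `(u, v) ↦ p + u a + v b` of a plane in space. -/
def planeMap (p a b : E3) (z : ℝ × ℝ) : E3 := p + (z.1 • a + z.2 • b)

/-- The linear map of the Euclidean plane into space with columns `a` and `b`. -/
def planeLinear (a b : E3) : EuclideanSpace ℝ (Fin 2) →ₗ[ℝ] E3 where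
  toFun x := x 0 • a + x 1 • b
  map_add' x y := by simp [add_smul]; abel
  map_smul' c x := by simp [mul_smul]

theorem inner_eq_sum (a b : E3) : inner ℝ a b = a 0 * b 0 + a 1 * b 1 + a 2 * b 2 := by
  simp [PiLp.inner_apply, Fin.sum_univ_three, mul_comm]

theorem cross_apply_zero (a b : E3) : cross a b 0 = a 1 * b 2 - a 2 * b 1 := by
  simp [cross, cross_apply]

theorem cross_apply_one (a b : E3) : cross a b 1 = a 2 * b 0 - a 0 * b 2 := by
  simp [cross, cross_apply]

theorem cross_apply_two (a b : E3) : cross a b 2 = a 0 * b 1 - a 1 * b 0 := by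
  simp [cross, cross_apply]

theorem norm_cross_sq (a b : E3) :
    ‖cross a b‖ ^ 2 = ‖a‖ ^ 2 * ‖b‖ ^ 2 - inner ℝ a b ^ 2 := by
  simp only [← real_inner_self_eq_norm_sq, inner_eq_sum, cross_apply_zero, cross_apply_one,
    cross_apply_two]
  ring

/-- Both squares equal the Gram determinant of `a` and `b`, by Lagrange's identity. -/
theorem normDet_planeLinear (a b : E3) : (planeLinear a b).normDet = ‖cross a b‖ := by
  rw [← sq_eq_sq₀ (LinearMap.normDet_nonneg _) (norm_nonneg _), norm_cross_sq]
  have h := (planeLinear a b).normDet_sq_eq_det_gram (EuclideanSpace.basisFun (Fin 2) ℝ)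
  simp only [RCLike.ofReal_real_eq_id, id] at h
  rw [h, Matrix.det_fin_two]
  simp [Matrix.gram_apply, planeLinear, real_inner_comm]
  ring

theorem euclideanHausdorffMeasure_image_planeMap (p a b : E3) (s : Set (ℝ × ℝ)) :
    μHE[2] (planeMap p a b '' s) = ENNReal.ofReal ‖cross a b‖ * volume s := by
  -- The product carries the sup metric, so it is first moved, preserving volume, to the Euclidean
  -- plane, where `μHE[2]` is Lebesgue measure.
  let e : ℝ × ℝ ≃ᵐ EuclideanSpace ℝ (Fin 2) :=
    MeasurableEquiv.finTwoArrow.symm.trans (MeasurableEquiv.toLp 2 _)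
  have he : MeasurePreserving e volume volume :=
    (PiLp.volume_preserving_toLp (Fin 2)).comp ((volume_preserving_finTwoArrow ℝ).symm _)
  have him : planeMap p a b '' s = (fun x => p + x) '' (planeLinear a b '' (e '' s)) := by
    rw [← Set.image_comp, ← Set.image_comp]
    rfl
  have hf := (planeLinear a b).euclideanHausdorffMeasure_image (e '' s)
  simp only [finrank_euclideanSpace, Fintype.card_fin] at hf
  rw [him, (isometry_add_left p).euclideanHausdorffMeasure_image, hf, normDet_planeLinear,
    EuclideanSpace.euclideanHausdorffMeasure_eq_volume, e.image_eq_preimage_symm,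
    he.symm.measure_preimage_equiv]

theorem continuous_planeMap (p a b : E3) : Continuous (planeMap p a b) := by
  unfold planeMap; fun_prop

theorem restrict_image_planeMap (p a b : E3) {s : Set (ℝ × ℝ)} :
    (μHE[2]).restrict (planeMap p a b '' s) =
      ENNReal.ofReal ‖cross a b‖ • (volume.restrict s).map (planeMap p a b) := by
  have hm := (continuous_planeMap p a b).measurable
  ext t ht
  rw [Measure.restrict_apply ht, Measure.smul_apply, Measure.map_apply hm ht,
    Measure.restrict_apply (hm ht), smul_eq_mul, ← euclideanHausdorffMeasure_image_planeMap p a b,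
    ← Set.image_preimage_inter, Set.inter_comm]

theorem integral_image_planeMap (p a b : E3) {s : Set (ℝ × ℝ)} {f : E3 → ℝ} (hf : Measurable f) :
    ∫ r in planeMap p a b '' s, f r ∂μHE[2] =
      ‖cross a b‖ * ∫ z in s, f (planeMap p a b z) := by
  rw [restrict_image_planeMap, integral_smul_measure,
    integral_map (continuous_planeMap p a b).aemeasurable hf.aestronglyMeasurable,
    ENNReal.toReal_ofReal (norm_nonneg _), smul_eq_mul]

theorem integrableOn_image_planeMap (p a b : E3) {s : Set (ℝ × ℝ)} {f : E3 → ℝ}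
    (hf : Measurable f) (h : IntegrableOn (fun z => f (planeMap p a b z)) s) :
    IntegrableOn f (planeMap p a b '' s) μHE[2] := by
  rw [IntegrableOn, restrict_image_planeMap]
  exact ((integrable_map_measure hf.aestronglyMeasurable
    (continuous_planeMap p a b).aemeasurable).2 h).smul_measure ENNReal.ofReal_ne_top

/-! ### Fubini and the divergence theorem on the standard triangle -/

/-- The standard closed triangle with vertices `(0, 0)`, `(1, 0)` and `(0, 1)`. -/
def stdTriangle : Set (ℝ × ℝ) := {z | 0 ≤ z.1 ∧ 0 ≤ z.2 ∧ z.1 + z.2 ≤ 1}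

theorem isClosed_stdTriangle : IsClosed stdTriangle :=
  (isClosed_le continuous_const continuous_fst).inter
    ((isClosed_le continuous_const continuous_snd).inter
      (isClosed_le (continuous_fst.add continuous_snd) continuous_const))

theorem isCompact_stdTriangle : IsCompact stdTriangle := by
  refine (isCompact_Icc (a := ((0 : ℝ), (0 : ℝ))) (b := (1, 1))).of_isClosed_subset
    isClosed_stdTriangle fun z hz => ?_
  obtain ⟨h1, h2, h3⟩ := hz
  exact ⟨⟨h1, h2⟩, ⟨by linarith, by linarith⟩⟩

theorem convex_stdTriangle : Convex ℝ stdTriangle := by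
  rintro ⟨x1, x2⟩ ⟨hx1, hx2, hx⟩ ⟨y1, y2⟩ ⟨hy1, hy2, hy⟩ a b ha hb hab
  simp only at hx1 hx2 hx hy1 hy2 hy
  refine ⟨?_, ?_, ?_⟩ <;> simp only [Prod.smul_mk, Prod.mk_add_mk, smul_eq_mul]
  · positivity
  · positivity
  · nlinarith

theorem integral_stdTriangle {F : ℝ × ℝ → ℝ} (hF : Continuous F) :
    ∫ z in stdTriangle, F z = ∫ u in (0 : ℝ)..1, ∫ v in (0 : ℝ)..(1 - u), F (u, v) := by
  have hm := isClosed_stdTriangle.measurableSet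
  have hi : IntegrableOn F stdTriangle := hF.continuousOn.integrableOn_compact isCompact_stdTriangle
  rw [← integral_indicator hm, Measure.volume_eq_prod,
    integral_prod _ (by rw [← Measure.volume_eq_prod]; exact hi.integrable_indicator hm),
    intervalIntegral.integral_of_le zero_le_one, ← integral_Icc_eq_integral_Ioc,
    ← integral_indicator measurableSet_Icc]
  refine integral_congr_ae (Filter.Eventually.of_forall fun u => ?_)
  simp only
  by_cases hu : u ∈ Set.Icc (0 : ℝ) 1
  · rw [Set.indicator_of_mem hu, intervalIntegral.integral_of_le (by linarith [hu.2]),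
      ← integral_Icc_eq_integral_Ioc, ← integral_indicator measurableSet_Icc]
    refine integral_congr_ae (Filter.Eventually.of_forall fun v => ?_)
    simp only
    by_cases hv : v ∈ Set.Icc 0 (1 - u)
    · rw [Set.indicator_of_mem hv, Set.indicator_of_mem]
      exact ⟨hu.1, hv.1, by linarith [hv.2]⟩
    · rw [Set.indicator_of_notMem hv, Set.indicator_of_notMem]
      exact fun h => hv ⟨h.2.1, by linarith [h.2.2]⟩
  · rw [Set.indicator_of_notMem hu]
    have : ∀ v, stdTriangle.indicator F (u, v) = 0 := fun v =>
      Set.indicator_of_notMem (fun h => hu ⟨h.1, by linarith [h.2.1, h.2.2]⟩) _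
    simp [this]

/-- The symmetry of the triangle reduces the `u`-derivative to the `v`-derivative in the divergence
theorem. -/
theorem integral_stdTriangle_swap (F : ℝ × ℝ → ℝ) :
    ∫ z in stdTriangle, F z.swap = ∫ z in stdTriangle, F z := by
  have h := (Measure.measurePreserving_swap (μ := (volume : Measure ℝ))
    (ν := (volume : Measure ℝ))).setIntegral_preimage_emb
    MeasurableEquiv.prodComm.measurableEmbedding F stdTriangle
  rw [← Measure.volume_eq_prod] at h
  convert! h using 3
  ext z
  simp only [stdTriangle, Set.mem_ofPred_eq, Set.mem_preimage, Prod.fst_swap, Prod.snd_swap]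
  constructor <;> rintro ⟨h1, h2, h3⟩ <;> exact ⟨h2, h1, by linarith⟩

theorem integral_stdTriangle_deriv_snd {Q Q' : ℝ × ℝ → ℝ} (hQ : Continuous Q)
    (hQ' : Continuous Q')
    (h : ∀ u v, HasDerivAt (fun y => Q (u, y)) (Q' (u, v)) v) :
    ∫ z in stdTriangle, Q' z =
      (∫ u in (0 : ℝ)..1, Q (u, 1 - u)) - ∫ u in (0 : ℝ)..1, Q (u, 0) := by
  rw [integral_stdTriangle hQ', ← intervalIntegral.integral_sub
    (Continuous.intervalIntegrable (by fun_prop) _ _)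
    (Continuous.intervalIntegrable (by fun_prop) _ _)]
  refine intervalIntegral.integral_congr fun u _ => ?_
  exact intervalIntegral.integral_eq_sub_of_hasDerivAt (fun v _ => h u v)
    (Continuous.intervalIntegrable (by fun_prop) _ _)

/-- The divergence theorem on the standard triangle. -/
theorem integral_stdTriangle_divergence {P P' Q Q' : ℝ × ℝ → ℝ} (hP : Continuous P)
    (hP' : Continuous P') (hQ : Continuous Q) (hQ' : Continuous Q')
    (hPd : ∀ u v, HasDerivAt (fun x => P (x, v)) (P' (u, v)) u)
    (hQd : ∀ u v, HasDerivAt (fun y => Q (u, y)) (Q' (u, v)) v) :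
    ∫ z in stdTriangle, (P' z + Q' z) =
      ((∫ v in (0 : ℝ)..1, P (1 - v, v)) - ∫ v in (0 : ℝ)..1, P (0, v)) +
        ((∫ u in (0 : ℝ)..1, Q (u, 1 - u)) - ∫ u in (0 : ℝ)..1, Q (u, 0)) := by
  rw [integral_add (hP'.continuousOn.integrableOn_compact isCompact_stdTriangle)
    (hQ'.continuousOn.integrableOn_compact isCompact_stdTriangle),
    integral_stdTriangle_deriv_snd hQ hQ' hQd, ← integral_stdTriangle_swap P']
  rw [integral_stdTriangle_deriv_snd (Q := fun z => P z.swap) (Q' := fun z => P' z.swap)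
    (by fun_prop) (by fun_prop) fun u v => hPd v u]
  rfl

/-! ### The radial field and its edge antiderivative -/

/-- The radial profile `g` of the vector field `g(R²) (r - ρ)` whose divergence in a plane at
distance `a` from the origin of `R` is `R⁻⁵`. -/
def radial (a Q : ℝ) : ℝ :=
  1 / 3 * (1 / (a ^ 3 * (√Q * (√Q + a))) + 1 / (a ^ 2 * √Q ^ 3))

/-- The derivative of `radial` in its second argument. -/
def radialDeriv (a Q : ℝ) : ℝ :=
  -(1 / 3 * ((2 * √Q + a) / (a ^ 3 * (√Q * (√Q + a)) ^ 2) + 3 / (a ^ 2 * √Q ^ 4))) * (1 / (2 * √Q))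

theorem hasDerivAt_radial {a Q : ℝ} (ha : 0 < a) (hQ : 0 < Q) :
    HasDerivAt (radial a) (radialDeriv a Q) Q := by
  have hR : 0 < √Q := Real.sqrt_pos.2 hQ
  have hs := Real.hasDerivAt_sqrt hQ.ne'
  have h1 := ((hs.mul (hs.add_const a)).const_mul (a ^ 3)).inv
    (show a ^ 3 * (√Q * (√Q + a)) ≠ 0 by positivity)
  have h2 := ((hs.pow 3).const_mul (a ^ 2)).inv (show a ^ 2 * √Q ^ 3 ≠ 0 by positivity)
  have h3 := (h1.add h2).const_mul (1 / 3)
  refine (h3.congr_deriv ?_).congr_of_eventuallyEq (Filter.Eventually.of_forall fun x => ?_)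
  · simp only [radialDeriv, Pi.mul_apply, Pi.pow_apply]
    field_simp
    ring
  · simp [radial]

/-- In the plane at distance `a`, `Q - a ^ 2` is `|r - ρ|²`, so the left side is the planar
divergence of `g(R²)(r - ρ)`. -/
theorem radial_divergence {a Q : ℝ} (ha : 0 < a) (hQ : 0 < Q) :
    2 * radial a Q + 2 * (Q - a ^ 2) * radialDeriv a Q = 1 / √Q ^ 5 := by
  have hR : 0 < √Q := Real.sqrt_pos.2 hQ
  have hsq : Q - a ^ 2 = √Q ^ 2 - a ^ 2 := by rw [Real.sq_sqrt hQ.le]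
  rw [hsq]
  unfold radial radialDeriv
  generalize √Q = R at *
  field_simp
  ring

/-- The antiderivative of `s ↦ 3 t g(s² + t² + a²)`. -/
def edgePrimitive (a t s : ℝ) : ℝ :=
  Real.arctan (t * s / (t ^ 2 + a ^ 2 + a * √(s ^ 2 + t ^ 2 + a ^ 2))) / a ^ 3 +
    t / a ^ 2 * (1 / (t ^ 2 + a ^ 2) * (s / √(s ^ 2 + t ^ 2 + a ^ 2)))

/-- The arctangent differentiates to `t / (R(R + a))` and `s / R` to `(t² + a²) / R³`, matching the
two terms of `radial`. The denominator inside the arctangent stays positive, so the principal branch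
is differentiable for all `s` and no jump of `π` arises. -/
theorem hasDerivAt_edgePrimitive {a : ℝ} (ha : 0 < a) (t s : ℝ) :
    HasDerivAt (edgePrimitive a t) (3 * t * radial a (s ^ 2 + t ^ 2 + a ^ 2)) s := by
  have hQ : 0 < s ^ 2 + t ^ 2 + a ^ 2 := by positivity
  have hR : 0 < √(s ^ 2 + t ^ 2 + a ^ 2) := Real.sqrt_pos.2 hQ
  have hsq : √(s ^ 2 + t ^ 2 + a ^ 2) ^ 2 = s ^ 2 + t ^ 2 + a ^ 2 := Real.sq_sqrt hQ.le
  have hq : HasDerivAt (fun s : ℝ => √(s ^ 2 + t ^ 2 + a ^ 2)) (s / √(s ^ 2 + t ^ 2 + a ^ 2)) s := by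
    have h := ((((hasDerivAt_id s).pow 2).add_const (t ^ 2)).add_const (a ^ 2)).sqrt hQ.ne'
    refine h.congr_deriv ?_
    simp only [id, Pi.pow_apply]
    field_simp
    simp
  have hD : 0 < t ^ 2 + a ^ 2 + a * √(s ^ 2 + t ^ 2 + a ^ 2) := by positivity
  have hN : HasDerivAt (fun s : ℝ => t * s) t s := by
    simpa using (hasDerivAt_id s).const_mul t
  have h1 := ((hN.div ((hq.const_mul a).const_add (t ^ 2 + a ^ 2)) hD.ne').arctan).div_const (a ^ 3)
  have h2 := ((((hasDerivAt_id s).div hq hR.ne').const_mul (1 / (t ^ 2 + a ^ 2)))).const_mul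
    (t / a ^ 2)
  refine (h1.add h2).congr_deriv ?_
  have hT : 0 < t ^ 2 + a ^ 2 := by positivity
  simp only [Pi.div_apply, id, radial]
  generalize √(s ^ 2 + t ^ 2 + a ^ 2) = R at *
  have e1 : 1 / (1 + (t * s / (t ^ 2 + a ^ 2 + a * R)) ^ 2) *
      ((t * (t ^ 2 + a ^ 2 + a * R) - t * s * (a * (s / R))) / (t ^ 2 + a ^ 2 + a * R) ^ 2) =
      t / (R * (R + a)) := by
    -- With `R² = s² + t² + a²` the sum of squares factors, which makes the derivative of the
    -- arctangent collapse.
    have h4 : (t ^ 2 + a ^ 2 + a * R) ^ 2 + (t * s) ^ 2 = (t ^ 2 + a ^ 2) * (R + a) ^ 2 := by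
      linear_combination (-t ^ 2) * hsq
    have h5 : t * (t ^ 2 + a ^ 2 + a * R) - t * s * (a * (s / R)) =
        t * (t ^ 2 + a ^ 2) * (R + a) / R := by
      field_simp
      linear_combination t * a * hsq
    have h6 : 1 + (t * s / (t ^ 2 + a ^ 2 + a * R)) ^ 2 =
        (t ^ 2 + a ^ 2) * (R + a) ^ 2 / (t ^ 2 + a ^ 2 + a * R) ^ 2 := by
      rw [← h4]; field_simp
    rw [h5, h6]
    field_simp
  have e2 : (1 * R - s * (s / R)) / R ^ 2 = (t ^ 2 + a ^ 2) / R ^ 3 := by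
    field_simp
    linear_combination hsq
  rw [e1, e2]
  field_simp

/-! ### Reduction of the area integral to the three sides -/

/-- The field has components `(u - u₀)g` and `(v - v₀)g`. The hypothesis `heuler` is Euler's
identity for `q - a²`, which in the application is a quadratic form centred at `(u₀, v₀)`. On each
side the flux factor is constant; on the hypotenuse the two components add up to `1 - u₀ - v₀`. -/
theorem integral_stdTriangle_radial {a u₀ v₀ : ℝ} (ha : 0 < a) {q q₁ q₂ : ℝ × ℝ → ℝ}
    (hq : Continuous q) (hq₁ : Continuous q₁) (hq₂ : Continuous q₂) (hpos : ∀ z, 0 < q z)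
    (hd₁ : ∀ u v, HasDerivAt (fun x => q (x, v)) (q₁ (u, v)) u)
    (hd₂ : ∀ u v, HasDerivAt (fun y => q (u, y)) (q₂ (u, v)) v)
    (heuler : ∀ z, (z.1 - u₀) * q₁ z + (z.2 - v₀) * q₂ z = 2 * (q z - a ^ 2)) :
    ∫ z in stdTriangle, 1 / √(q z) ^ 5 =
      (1 - u₀ - v₀) * (∫ v in (0 : ℝ)..1, radial a (q (1 - v, v))) +
        u₀ * (∫ v in (0 : ℝ)..1, radial a (q (0, v))) +
        v₀ * ∫ u in (0 : ℝ)..1, radial a (q (u, 0)) := by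
  have hR : ∀ z, 0 < √(q z) := fun z => Real.sqrt_pos.2 (hpos z)
  have hg : Continuous fun z => radial a (q z) := by
    unfold radial
    fun_prop (disch := intro z; have := hR z; positivity)
  have hg' : Continuous fun z => radialDeriv a (q z) := by
    unfold radialDeriv
    fun_prop (disch := intro z; have := hR z; positivity)
  have hdiv := integral_stdTriangle_divergence
    (P := fun z => radial a (q z) * (z.1 - u₀))
    (P' := fun z => radialDeriv a (q z) * q₁ z * (z.1 - u₀) + radial a (q z))
    (Q := fun z => radial a (q z) * (z.2 - v₀))
    (Q' := fun z => radialDeriv a (q z) * q₂ z * (z.2 - v₀) + radial a (q z))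
    (by fun_prop) (by fun_prop) (by fun_prop) (by fun_prop)
    (fun u v => by
      have h := ((hasDerivAt_radial ha (hpos (u, v))).comp u (hd₁ u v)).mul
        ((hasDerivAt_id u).sub_const u₀)
      exact h.congr_deriv (by simp))
    (fun u v => by
      have h := ((hasDerivAt_radial ha (hpos (u, v))).comp v (hd₂ u v)).mul
        ((hasDerivAt_id v).sub_const v₀)
      exact h.congr_deriv (by simp))
  have hint : ∀ z, 1 / √(q z) ^ 5 =
      radialDeriv a (q z) * q₁ z * (z.1 - u₀) + radial a (q z) +
        (radialDeriv a (q z) * q₂ z * (z.2 - v₀) + radial a (q z)) := fun z => by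
    rw [← radial_divergence ha (hpos z)]
    linear_combination (-radialDeriv a (q z)) * heuler z
  simp only [hint, hdiv]
  -- The divergence theorem parametrises the hypotenuse once by `u` and once by `v`; reversing one
  -- of them lets the factors be added.
  have hsub : ∫ u in (0 : ℝ)..1, radial a (q (u, 1 - u)) * (1 - u - v₀) =
      ∫ v in (0 : ℝ)..1, radial a (q (1 - v, v)) * (v - v₀) := by
    have h := intervalIntegral.integral_comp_sub_left (a := 0) (b := 1)
      (fun u => radial a (q (u, 1 - u)) * (1 - u - v₀)) 1
    simp only [sub_sub_cancel, sub_self, sub_zero] at h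
    exact h.symm
  have hg₁ : Continuous fun v : ℝ => radial a (q (1 - v, v)) :=
    hg.comp (by fun_prop : Continuous fun v : ℝ => (1 - v, v))
  have hadd : (∫ v in (0 : ℝ)..1, radial a (q (1 - v, v)) * (1 - v - u₀)) +
      (∫ v in (0 : ℝ)..1, radial a (q (1 - v, v)) * (v - v₀)) =
      (1 - u₀ - v₀) * ∫ v in (0 : ℝ)..1, radial a (q (1 - v, v)) := by
    rw [← intervalIntegral.integral_add (Continuous.intervalIntegrable (by fun_prop) _ _)
      (Continuous.intervalIntegrable (by fun_prop) _ _), ← intervalIntegral.integral_const_mul]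
    refine intervalIntegral.integral_congr fun v _ => ?_
    ring
  rw [hsub, intervalIntegral.integral_mul_const, intervalIntegral.integral_mul_const, ← hadd]
  ring

theorem inner_planeMap_sub {p a b r n : E3} {u₀ v₀ w : ℝ} (ha : inner ℝ a n = 0)
    (hb : inner ℝ b n = 0) (hn : ‖n‖ = 1) (hρ : r + w • n = planeMap p a b (u₀, v₀))
    (z : ℝ × ℝ) : inner ℝ (planeMap p a b z - r) n = w := by
  have h : planeMap p a b z - r = (z.1 - u₀) • a + (z.2 - v₀) • b + w • n := by
    rw [← sub_eq_zero, ← sub_eq_zero.2 hρ.symm]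
    simp only [planeMap]
    module
  rw [h, inner_add_left, inner_add_left, inner_smul_left, inner_smul_left, inner_smul_left, ha, hb,
    real_inner_self_eq_norm_sq, hn]
  simp

theorem integral_stdTriangle_planeMap {p a b r n : E3} {u₀ v₀ w : ℝ} (hw : w ≠ 0)
    (ha : inner ℝ a n = 0) (hb : inner ℝ b n = 0) (hn : ‖n‖ = 1)
    (hρ : r + w • n = planeMap p a b (u₀, v₀)) :
    ∫ z in stdTriangle, 1 / ‖planeMap p a b z - r‖ ^ 5 =
      (1 - u₀ - v₀) *
        (∫ v in (0 : ℝ)..1, radial |w| (‖planeMap p a b (1 - v, v) - r‖ ^ 2)) +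
        u₀ * (∫ v in (0 : ℝ)..1, radial |w| (‖planeMap p a b (0, v) - r‖ ^ 2)) +
        v₀ * ∫ u in (0 : ℝ)..1, radial |w| (‖planeMap p a b (u, 0) - r‖ ^ 2) := by
  have hcont := continuous_planeMap p a b
  have hi := inner_planeMap_sub ha hb hn hρ
  have hpos : ∀ z, 0 < ‖planeMap p a b z - r‖ ^ 2 := fun z => by
    have : planeMap p a b z - r ≠ 0 := fun h => hw (by rw [← hi z, h, inner_zero_left])
    positivity
  have key := integral_stdTriangle_radial (a := |w|) (u₀ := u₀) (v₀ := v₀) (abs_pos.2 hw)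
    (q := fun z => ‖planeMap p a b z - r‖ ^ 2)
    (q₁ := fun z => 2 * inner ℝ (planeMap p a b z - r) a)
    (q₂ := fun z => 2 * inner ℝ (planeMap p a b z - r) b)
    (by fun_prop) (by fun_prop) (by fun_prop) hpos
    (fun u v => by
      have h : HasDerivAt (fun x : ℝ => planeMap p a b (x, v) - r) a u := by
        simpa [planeMap] using
          ((((hasDerivAt_id u).smul_const a).add_const (v • b)).const_add p).sub_const r
      exact h.norm_sq)
    (fun u v => by
      have h : HasDerivAt (fun y : ℝ => planeMap p a b (u, y) - r) b v := by
        simpa [planeMap] using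
          ((((hasDerivAt_id v).smul_const b).const_add (u • a)).const_add p).sub_const r
      exact h.norm_sq)
    (fun z => by
      have h : (z.1 - u₀) • a + (z.2 - v₀) • b = (planeMap p a b z - r) - w • n := by
        rw [← sub_eq_zero, ← sub_eq_zero.2 hρ]
        simp only [planeMap]
        module
      have h' : (z.1 - u₀) * inner ℝ (planeMap p a b z - r) a +
          (z.2 - v₀) * inner ℝ (planeMap p a b z - r) b = ‖planeMap p a b z - r‖ ^ 2 - w * w := by
        rw [← real_inner_smul_right, ← real_inner_smul_right, ← inner_add_right, h,
          inner_sub_right, real_inner_smul_right, hi z, real_inner_self_eq_norm_sq]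
      rw [sq_abs]
      linear_combination 2 * h')
  simpa only [Real.sqrt_sq (norm_nonneg _)] using key

/-! ### Cross product identities and the integral along a segment -/

/-- The squared triple product is the Gram determinant of `x`, `a`, `b`. -/
theorem inner_cross_sq (x a b : E3) :
    inner ℝ x (cross a b) ^ 2 = ‖x‖ ^ 2 * ‖a‖ ^ 2 * ‖b‖ ^ 2 +
      2 * inner ℝ x a * inner ℝ a b * inner ℝ x b - ‖x‖ ^ 2 * inner ℝ a b ^ 2 -
      ‖a‖ ^ 2 * inner ℝ x b ^ 2 - ‖b‖ ^ 2 * inner ℝ x a ^ 2 := by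
  simp only [← real_inner_self_eq_norm_sq, inner_eq_sum, cross_apply_zero, cross_apply_one,
    cross_apply_two]
  ring

theorem norm_sq_eq_of_orthonormal {s n : E3} (hs : ‖s‖ = 1) (hn : ‖n‖ = 1) (hsn : inner ℝ s n = 0)
    (x : E3) :
    ‖x‖ ^ 2 = inner ℝ x s ^ 2 + inner ℝ x (cross s n) ^ 2 + inner ℝ x n ^ 2 := by
  rw [inner_cross_sq, hs, hn, hsn]
  ring

theorem inner_cross_self_left (a b : E3) : inner ℝ a (cross a b) = 0 := by
  simp only [inner_eq_sum, cross_apply_zero, cross_apply_one, cross_apply_two]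
  ring

theorem inner_cross_self_right (a b : E3) : inner ℝ b (cross a b) = 0 := by
  simp only [inner_eq_sum, cross_apply_zero, cross_apply_one, cross_apply_two]
  ring

theorem cross_smul_left (c : ℝ) (a b : E3) : cross (c • a) b = c • cross a b := by
  simp [cross]

theorem cross_smul_right (c : ℝ) (a b : E3) : cross a (c • b) = c • cross a b := by
  simp [cross]

/-- In the frame `s`, `s × n`, `n` only the coordinate along `s` varies on the segment. Keeping the
factor `t` on the left covers `t = 0`, when the line of the segment passes through `ρ`, without
division. -/
theorem integral_segment_radial {c e ρ r s n : E3} {l w : ℝ} (hs : ‖s‖ = 1) (hn : ‖n‖ = 1)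
    (hsn : inner ℝ s n = 0) (he : e = l • s) (hw : w ≠ 0) (hρ : ρ = r + w • n)
    (hc : inner ℝ (c - r) n = w) :
    inner ℝ (c - ρ) (cross s n) * l * (∫ τ in (0 : ℝ)..1, radial |w| (‖c + τ • e - r‖ ^ 2)) =
      1 / 3 * (edgePrimitive |w| (inner ℝ (c - ρ) (cross s n)) (inner ℝ (c + e - ρ) s) -
        edgePrimitive |w| (inner ℝ (c - ρ) (cross s n)) (inner ℝ (c - ρ) s)) := by
  subst he
  set t := inner ℝ (c - ρ) (cross s n) with ht
  set σ := inner ℝ (c - ρ) s with hσ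
  have hns : inner ℝ n s = 0 := by rw [real_inner_comm, hsn]
  have hss : inner ℝ s s = (1 : ℝ) := by rw [real_inner_self_eq_norm_sq, hs, one_pow]
  have hend : inner ℝ (c + l • s - ρ) s = σ + l := by
    rw [add_sub_right_comm, inner_add_left, inner_smul_left, hss]
    simp [hσ]
  have hnorm : ∀ τ : ℝ, ‖c + τ • l • s - r‖ ^ 2 = (σ + τ * l) ^ 2 + t ^ 2 + |w| ^ 2 := fun τ => by
    have hx : c + τ • l • s - r = (c - r) + (τ * l) • s := by module
    have hσ' : inner ℝ (c - r) s = σ := by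
      rw [hσ, hρ, ← sub_sub, inner_sub_left _ (w • n), inner_smul_left, hns]; simp
    have ht' : inner ℝ (c - r) (cross s n) = t := by
      rw [ht, hρ, ← sub_sub, inner_sub_left _ (w • n), inner_smul_left, inner_cross_self_right]
      simp
    rw [norm_sq_eq_of_orthonormal hs hn hsn, hx]
    simp only [inner_add_left, inner_smul_left, hσ', ht', hc, hss, hsn, inner_cross_self_left,
      sq_abs]
    simp
  rw [hend]
  simp only [hnorm]
  have hw' := abs_pos.2 hw
  have hd : ∀ τ : ℝ, HasDerivAt (fun τ => edgePrimitive |w| t (σ + τ * l))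
      (3 * t * radial |w| ((σ + τ * l) ^ 2 + t ^ 2 + |w| ^ 2) * l) τ := fun τ => by
    have h1 : HasDerivAt (fun τ : ℝ => σ + τ * l) l τ := by
      simpa using ((hasDerivAt_id τ).mul_const l).const_add σ
    exact (hasDerivAt_edgePrimitive hw' t _).comp τ h1
  have hR : ∀ τ : ℝ, 0 < √((σ + τ * l) ^ 2 + t ^ 2 + |w| ^ 2) := fun τ =>
    Real.sqrt_pos.2 (by positivity)
  have hcont : Continuous fun τ : ℝ => radial |w| ((σ + τ * l) ^ 2 + t ^ 2 + |w| ^ 2) := by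
    unfold radial
    fun_prop (disch := intro z; have := hR z; positivity)
  have h := intervalIntegral.integral_eq_sub_of_hasDerivAt (a := 0) (b := 1) (fun τ _ => hd τ)
    (Continuous.intervalIntegrable (by fun_prop) _ _)
  rw [intervalIntegral.integral_mul_const, intervalIntegral.integral_const_mul] at h
  simp only [one_mul, zero_mul, add_zero] at h
  rw [← h]
  ring

theorem exists_eq_smul_add_smul_of_inner_cross_eq_zero {a b x : E3} (h : cross a b ≠ 0)
    (hx : inner ℝ x (cross a b) = 0) : ∃ u v : ℝ, x = u • a + v • b := by
  have hN : ‖cross a b‖ ^ 2 ≠ 0 := by positivity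
  -- Cramer's rule in the basis `a`, `b`, `a × b`; the third coefficient vanishes by `hx`.
  refine ⟨inner ℝ (cross x b) (cross a b) / ‖cross a b‖ ^ 2,
    inner ℝ (cross a x) (cross a b) / ‖cross a b‖ ^ 2, ?_⟩
  have key : ‖cross a b‖ ^ 2 • x = inner ℝ (cross x b) (cross a b) • a +
      inner ℝ (cross a x) (cross a b) • b + inner ℝ x (cross a b) • cross a b := by
    ext i
    fin_cases i <;>
    · simp only [← real_inner_self_eq_norm_sq, inner_eq_sum, cross_apply_zero, cross_apply_one,
        cross_apply_two, PiLp.add_apply, PiLp.smul_apply, smul_eq_mul, Fin.zero_eta, Fin.mk_one,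
        Fin.reduceFinMk]
      ring
  rw [hx, zero_smul, add_zero] at key
  rw [div_eq_inv_mul, div_eq_inv_mul, mul_smul, mul_smul, ← smul_add, ← key, inv_smul_smul₀ hN]

theorem norm_sq_smul_eq_of_cross_eq_zero {a b : E3} (h : cross a b = 0) :
    ‖a‖ ^ 2 • b = inner ℝ a b • a := by
  -- The expansion of the double product `a × (a × b)`.
  have key : ‖a‖ ^ 2 • b = inner ℝ a b • a - cross a (cross a b) := by
    ext i
    fin_cases i <;>
    · simp only [← real_inner_self_eq_norm_sq, inner_eq_sum, cross_apply_zero, cross_apply_one,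
        cross_apply_two, PiLp.sub_apply, PiLp.smul_apply, smul_eq_mul, Fin.zero_eta, Fin.mk_one,
        Fin.reduceFinMk]
      ring
  rw [key, h]
  simp [cross]

/-! ### The triangle, its normal and its edges -/

theorem norm_unit {a : E3} (h : a ≠ 0) : ‖unit a‖ = 1 := by
  rw [unit, norm_smul, norm_inv, norm_norm, inv_mul_cancel₀ (norm_ne_zero_iff.2 h)]

theorem norm_smul_unit (a : E3) : ‖a‖ • unit a = a := by
  by_cases h : a = 0
  · simp [h, unit]
  · rw [unit, smul_inv_smul₀ (norm_ne_zero_iff.2 h)]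

theorem region_eq_image_planeMap (T : Affine.Triangle ℝ E3) :
    region T = planeMap (T.points 0) (T.points 1 - T.points 0) (T.points 2 - T.points 0) ''
      stdTriangle := by
  apply Set.Subset.antisymm
  · refine convexHull_min ?_ ?_
    · rintro _ ⟨i, rfl⟩
      fin_cases i
      · exact ⟨(0, 0), by simp [stdTriangle], by simp [planeMap]⟩
      · exact ⟨(1, 0), by simp [stdTriangle], by simp [planeMap]⟩
      · exact ⟨(0, 1), by simp [stdTriangle], by simp [planeMap]⟩
    · rintro _ ⟨x, hx, rfl⟩ _ ⟨y, hy, rfl⟩ c d hc hd hcd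
      refine ⟨c • x + d • y, convex_stdTriangle hx hy hc hd hcd, ?_⟩
      obtain rfl : d = 1 - c := by linarith
      simp only [planeMap, Prod.fst_add, Prod.snd_add, Prod.smul_fst, Prod.smul_snd, smul_eq_mul]
      module
  · rintro _ ⟨⟨u, v⟩, ⟨hu, hv, huv⟩, rfl⟩
    have hmem : ∀ i, T.points i ∈ region T := fun i => subset_convexHull ℝ _ ⟨i, rfl⟩
    have h := (convex_convexHull ℝ (Set.range T.points)).sum_mem (t := Finset.univ)
      (w := ![1 - u - v, u, v]) (z := T.points)
      (by
        simp only at hu hv huv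
        intro i _
        fin_cases i
        · change 0 ≤ 1 - u - v
          linarith
        · exact hu
        · exact hv)
      (by simp [Fin.sum_univ_three]; ring) (fun i _ => hmem i)
    rw [Fin.sum_univ_three] at h
    change (1 - u - v) • T.points 0 + u • T.points 1 + v • T.points 2 ∈ region T at h
    have he : planeMap (T.points 0) (T.points 1 - T.points 0) (T.points 2 - T.points 0) (u, v) =
        (1 - u - v) • T.points 0 + u • T.points 1 + v • T.points 2 := by
      simp only [planeMap]
      module
    rwa [he]

theorem cross_ne_zero (T : Affine.Triangle ℝ E3) :
    cross (T.points 1 - T.points 0) (T.points 2 - T.points 0) ≠ 0 := by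
  intro h
  have hne : T.points 1 - T.points 0 ≠ 0 :=
    sub_ne_zero.2 (T.independent.injective.ne (by decide))
  have h2 := norm_sq_smul_eq_of_cross_eq_zero h
  have hcol := affineIndependent_iff_not_collinear.1 T.independent
  refine hcol ((collinear_iff_of_mem (Set.mem_range_self (0 : Fin 3))).2
    ⟨T.points 1 - T.points 0, ?_⟩)
  rintro _ ⟨i, rfl⟩
  fin_cases i
  · exact ⟨0, by simp⟩
  · exact ⟨1, by simp⟩
  · refine ⟨inner ℝ (T.points 1 - T.points 0) (T.points 2 - T.points 0) /
      ‖T.points 1 - T.points 0‖ ^ 2, ?_⟩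
    have hN : ‖T.points 1 - T.points 0‖ ^ 2 ≠ 0 := by positivity
    rw [div_eq_inv_mul, mul_smul, ← h2, inv_smul_smul₀ hN]
    simp

theorem cross_edge (T : Affine.Triangle ℝ E3) :
    cross (edge T 0) (edge T 1) =
      cross (T.points 1 - T.points 0) (T.points 2 - T.points 0) := by
  change cross (T.points 2 - T.points 1) (T.points 0 - T.points 2) = _
  ext i
  fin_cases i <;>
  · simp [cross_apply_zero, cross_apply_one, cross_apply_two]
    ring

theorem norm_wHat (T : Affine.Triangle ℝ E3) : ‖wHat T‖ = 1 :=
  norm_unit (cross_edge T ▸ cross_ne_zero T)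

theorem wHat_eq (T : Affine.Triangle ℝ E3) :
    wHat T = ‖cross (T.points 1 - T.points 0) (T.points 2 - T.points 0)‖⁻¹ •
      cross (T.points 1 - T.points 0) (T.points 2 - T.points 0) := by
  rw [wHat, cross_edge, unit]

theorem inner_sub_zero_wHat (T : Affine.Triangle ℝ E3) (i : Fin 3) :
    inner ℝ (T.points i - T.points 0) (wHat T) = 0 := by
  rw [wHat_eq, real_inner_smul_right]
  fin_cases i
  · simp
  · exact mul_eq_zero_of_right _ (inner_cross_self_left _ _)
  · exact mul_eq_zero_of_right _ (inner_cross_self_right _ _)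

theorem inner_points_sub_wHat (T : Affine.Triangle ℝ E3) (r0 : E3) (i : Fin 3) :
    inner ℝ (T.points i - r0) (wHat T) = w0 T r0 := by
  rw [w0, ← sub_add_sub_cancel _ (T.points 0), inner_add_left, inner_sub_zero_wHat, zero_add]

theorem inner_edge_wHat (T : Affine.Triangle ℝ E3) (i : Fin 3) :
    inner ℝ (edge T i) (wHat T) = 0 := by
  rw [edge, ← sub_sub_sub_cancel_right _ _ (T.points 0), inner_sub_left, inner_sub_zero_wHat,
    inner_sub_zero_wHat, sub_zero]

theorem edge_ne_zero (T : Affine.Triangle ℝ E3) (i : Fin 3) : edge T i ≠ 0 :=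
  sub_ne_zero.2 (T.independent.injective.ne (by fin_cases i <;> decide))

theorem edgePrimitive_sub_eq (T : Affine.Triangle ℝ E3) (r0 : E3) (i : Fin 3) :
    edgePrimitive |w0 T r0| (t0 T r0 i) (sPlus T r0 i) -
        edgePrimitive |w0 T r0| (t0 T r0 i) (sMinus T r0 i) =
      betaEdge T r0 i / |w0 T r0| ^ 3 + t0 T r0 i / w0 T r0 ^ 2 * Rs T r0 i := by
  have hR : R0 T r0 i ^ 2 = t0 T r0 i ^ 2 + w0 T r0 ^ 2 := Real.sq_sqrt (by positivity)
  simp only [edgePrimitive, betaEdge, Rs, hR, RPlus, RMinus, sq_abs]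
  ring

theorem integral_edge_radial (T : Affine.Triangle ℝ E3) (r0 : E3) (hw : w0 T r0 ≠ 0) (i : Fin 3) :
    t0 T r0 i * ‖edge T i‖ *
        (∫ τ in (0 : ℝ)..1, radial |w0 T r0| (‖T.points (i + 1) + τ • edge T i - r0‖ ^ 2)) =
      1 / 3 * (betaEdge T r0 i / |w0 T r0| ^ 3 + t0 T r0 i / w0 T r0 ^ 2 * Rs T r0 i) := by
  have h := integral_segment_radial (c := T.points (i + 1)) (e := edge T i) (ρ := rho T r0)
    (r := r0) (s := sHat T i) (n := wHat T) (l := ‖edge T i‖) (w := w0 T r0)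
    (norm_unit (edge_ne_zero T i)) (norm_wHat T)
    (by rw [sHat, unit, real_inner_smul_left, inner_edge_wHat, mul_zero])
    (norm_smul_unit _).symm hw rfl (inner_points_sub_wHat T r0 _)
  rw [← edgePrimitive_sub_eq]
  have he : T.points (i + 1) + edge T i = T.points (i - 1) := by simp [edge]
  rw [he] at h
  exact h

/-- Multiplying by the edge length removes the normalisation of `sHat`, leaving an expression
polynomial in coordinates apart from one factor `|a × b|⁻¹`. -/
theorem t0_mul_norm_edge (T : Affine.Triangle ℝ E3) (r0 : E3) (i : Fin 3) :
    t0 T r0 i * ‖edge T i‖ =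
      ‖cross (T.points 1 - T.points 0) (T.points 2 - T.points 0)‖⁻¹ *
        inner ℝ (T.points (i + 1) - rho T r0)
          (cross (edge T i) (cross (T.points 1 - T.points 0) (T.points 2 - T.points 0))) := by
  rw [t0, mHat, mul_comm, ← real_inner_smul_right, ← cross_smul_left, sHat, norm_smul_unit, wHat_eq,
    cross_smul_right, real_inner_smul_right]

end TriangleIntegral
end

/-! ### Assembly of the formula -/

open TriangleIntegral in
/-- `μHE[2]` is surface measure: two-dimensional Hausdorff measure normalised to agree with
Lebesgue measure on planes. -/
theorem mainTheorem3 (T : Affine.Triangle ℝ TriangleIntegral.E3) (r0 : TriangleIntegral.E3)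
    (hw : TriangleIntegral.w0 T r0 ≠ 0) :
    IntegrableOn (fun r : TriangleIntegral.E3 => 1 / ‖r - r0‖ ^ 5)
        (TriangleIntegral.region T) μHE[2] ∧
      ∫ r in TriangleIntegral.region T, 1 / ‖r - r0‖ ^ 5 ∂μHE[2] =
        1 / 3 * (TriangleIntegral.beta T r0 / |TriangleIntegral.w0 T r0| ^ 3 +
          ∑ i : Fin 3, TriangleIntegral.t0 T r0 i / TriangleIntegral.w0 T r0 ^ 2 *
            TriangleIntegral.Rs T r0 i) := by
  have hmeas : Measurable fun r : E3 => 1 / ‖r - r0‖ ^ 5 := by fun_prop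
  have h0 := integral_edge_radial T r0 hw 0
  have h1 := integral_edge_radial T r0 hw 1
  have h2 := integral_edge_radial T r0 hw 2
  have t_zero := t0_mul_norm_edge T r0 0
  have t_one := t0_mul_norm_edge T r0 1
  have t_two := t0_mul_norm_edge T r0 2
  have ha := inner_sub_zero_wHat T 1
  have hb := inner_sub_zero_wHat T 2
  have hN := cross_ne_zero T
  simp only [edge, show (0 : Fin 3) - 1 = 2 from rfl, show (0 : Fin 3) + 1 = 1 from rfl,
    show (1 : Fin 3) - 1 = 0 from rfl, show (1 : Fin 3) + 1 = 2 from rfl,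
    show (2 : Fin 3) - 1 = 1 from rfl, show (2 : Fin 3) + 1 = 0 from rfl]
    at h0 h1 h2 t_zero t_one t_two
  rw [region_eq_image_planeMap]
  set p := T.points 0
  set a := T.points 1 - p with ha_def
  set b := T.points 2 - p with hb_def
  have hcont := continuous_planeMap p a b
  have hJ : 0 < ‖cross a b‖ := norm_pos_iff.2 hN
  obtain ⟨u₀, v₀, huv⟩ : ∃ u v : ℝ, rho T r0 - p = u • a + v • b := by
    refine exists_eq_smul_add_smul_of_inner_cross_eq_zero hN ?_
    have h : inner ℝ (rho T r0 - p) (wHat T) = 0 := by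
      have hρ : rho T r0 - p = w0 T r0 • wHat T - (p - r0) := by rw [rho]; abel
      rw [hρ, inner_sub_left, real_inner_smul_left, real_inner_self_eq_norm_sq, norm_wHat,
        inner_points_sub_wHat]
      ring
    rw [wHat_eq, real_inner_smul_right] at h
    exact (mul_eq_zero.1 h).resolve_left (inv_ne_zero hJ.ne')
  have hρ : r0 + w0 T r0 • wHat T = planeMap p a b (u₀, v₀) := by
    change rho T r0 = _
    rw [planeMap, ← huv]; abel
  have hne : ∀ z, ‖planeMap p a b z - r0‖ ≠ 0 := fun z h => hw (by
    rw [← inner_planeMap_sub ha hb (norm_wHat T) hρ z, norm_eq_zero.1 h, inner_zero_left])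
  refine ⟨integrableOn_image_planeMap p a b hmeas (ContinuousOn.integrableOn_compact
    isCompact_stdTriangle (Continuous.continuousOn
      (by fun_prop (disch := exact fun z => pow_ne_zero _ (hne z))))), ?_⟩
  rw [integral_image_planeMap p a b hmeas,
    integral_stdTriangle_planeMap hw ha hb (norm_wHat T) hρ]
  have hp1 : T.points 1 = p + a := by rw [ha_def]; abel
  have hp2 : T.points 2 = p + b := by rw [hb_def]; abel
  have hρ' : rho T r0 = p + (u₀ • a + v₀ • b) := hρ
  rw [hp1, hp2] at h0 t_zero
  rw [hp2] at h1 t_one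
  -- Twice the signed area of the triangle spanned by `ρ` and a side is `|a × b|` times the
  -- barycentric coordinate of `ρ` at the opposite vertex.
  have l_zero : t0 T r0 0 * ‖p + b - (p + a)‖ = ‖cross a b‖ * (1 - u₀ - v₀) := by
    rw [t_zero, hρ', inv_mul_eq_iff_eq_mul₀ hJ.ne', ← mul_assoc, ← sq]
    simp only [← real_inner_self_eq_norm_sq, inner_eq_sum, cross_apply_zero, cross_apply_one,
      cross_apply_two, PiLp.add_apply, PiLp.sub_apply, PiLp.smul_apply, smul_eq_mul]
    ring
  have l_one : t0 T r0 1 * ‖p - (p + b)‖ = ‖cross a b‖ * u₀ := by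
    rw [t_one, hρ', inv_mul_eq_iff_eq_mul₀ hJ.ne', ← mul_assoc, ← sq]
    simp only [← real_inner_self_eq_norm_sq, inner_eq_sum, cross_apply_zero, cross_apply_one,
      cross_apply_two, PiLp.add_apply, PiLp.sub_apply, PiLp.smul_apply, smul_eq_mul]
    ring
  have l_two : t0 T r0 2 * ‖a‖ = ‖cross a b‖ * v₀ := by
    rw [t_two, hρ', inv_mul_eq_iff_eq_mul₀ hJ.ne', ← mul_assoc, ← sq]
    simp only [← real_inner_self_eq_norm_sq, inner_eq_sum, cross_apply_zero, cross_apply_one,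
      cross_apply_two, PiLp.add_apply, PiLp.sub_apply, PiLp.smul_apply, smul_eq_mul]
    ring
  rw [l_zero] at h0
  rw [l_one] at h1
  rw [l_two] at h2
  have i_zero : ∀ v : ℝ, p + a + v • (p + b - (p + a)) = planeMap p a b (1 - v, v) := fun v => by
    simp only [planeMap]; module
  have i_one : ∀ v : ℝ, p + b + v • (p - (p + b)) = planeMap p a b (0, 1 - v) := fun v => by
    simp only [planeMap]; module
  have i_two : ∀ v : ℝ, p + v • a = planeMap p a b (v, 0) := fun v => by
    simp only [planeMap]; module
  -- Edge `1` runs from `p + b` back to `p`, against the parameter `v`.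
  have i_rev := intervalIntegral.integral_comp_sub_left (a := 0) (b := 1)
    (fun v => radial |w0 T r0| (‖planeMap p a b (0, v) - r0‖ ^ 2)) 1
  rw [sub_self, sub_zero] at i_rev
  simp only [i_zero] at h0
  simp only [i_one, i_rev] at h1
  simp only [i_two] at h2
  rw [beta, Fin.sum_univ_three, Fin.sum_univ_three]
  linear_combination h0 + h1 + h2
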